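/- For positive integers $m,n$ and a density matrix $\rho$ on $\mathbb{C}^m\otimes\mathbb{C}^n$, let $$E_r(\rho)=\inf_{\sigma\in\mathcal{S}} S(\rho\|\sigma),\qquad S(\rho\|\sigma)=\operatorname{tr}\big(\rho(\log_2\rho-\log_2\sigma)\big)$$ be the relative entropy of entanglement, where $\mathcal{S}$ is the set of separable states (convex combinations of product states $A\otimes B$ of density matrices) and $S(\rho\|\sigma)=+\infty$ if the support of $\rho$ is not contained in the support of $\sigma$. Let $N(\rho)=\tfrac12\big(\|\rho^{\Gamma}\|_{\mathrm{tr}}-1\big)$ be the negativity, where $\rho^\Gamma$ is the partial transpose of $\rho$ on the second tensor factor and $\|\cdot\|_{\mathrm{tr}}$ is the trace norm. Then for every pure state (unit vector) $|y\rangle\in\mathbb{C}^m\otimes\mathbb{C}^n$, $$E_r(|y\rangle\langle y|)\le 2N(|y\rangle\langle y|).$$ Moreover, this bound is strictly smaller than the known bound $\log_2\big(1+2N(|y\rangle\langle y|)\big)$ exactly when $0<N(|y\rangle\langle y|)<\tfrac12$. -/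

import Mathlib

open scoped Kronecker ComplexOrder

noncomputable section

namespace QuantumInfo

/-- Density matrices: positive semidefinite matrices of trace one. -/
def IsDensity {ι : Type*} [Fintype ι] (ρ : Matrix ι ι ℂ) : Prop :=
  ρ.PosSemidef ∧ ρ.trace = 1

/-- The rank-one matrix `|y⟩⟨y|`. -/
def ketbra {ι : Type*} (y : EuclideanSpace ℂ ι) : Matrix ι ι ℂ :=
  Matrix.of fun i j => y i * star (y j)

/-- Separable states of a bipartite system: (finite) convex combinations of product states.
The space `ℂ^α ⊗ ℂ^β` is identified with `ℂ^(α × β)` through its product basis, so that the tensor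
product of operators is the Kronecker product. -/
def separableStates (α β : Type*) [Fintype α] [Fintype β] :
    Set (Matrix (α × β) (α × β) ℂ) :=
  convexHull ℝ {τ | ∃ (A : Matrix α α ℂ) (B : Matrix β β ℂ),
    IsDensity A ∧ IsDensity B ∧ τ = A ⊗ₖ B}

/-- The matrix logarithm to base two of a Hermitian matrix, by the functional calculus, with the
convention `log 0 = 0` on the kernel. -/
def log2 {ι : Type*} [Fintype ι] [DecidableEq ι] (ρ : Matrix ι ι ℂ) : Matrix ι ι ℂ :=
  cfc (Real.logb 2) ρ

open Classical in
/-- The quantum relative entropy `S(ρ‖σ) = tr (ρ (log₂ ρ - log₂ σ))`, which is `+∞` unless the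
support of `ρ` is contained in the support of `σ`, i.e. unless `ker σ ⊆ ker ρ`. -/
def relEntropy {ι : Type*} [Fintype ι] [DecidableEq ι] (ρ σ : Matrix ι ι ℂ) : EReal :=
  if ∀ v : ι → ℂ, σ.mulVec v = 0 → ρ.mulVec v = 0 then
    (((ρ * (log2 ρ - log2 σ)).trace.re : ℝ) : EReal)
  else ⊤

/-- The relative entropy of entanglement: the smallest relative entropy to a separable state. -/
def relEntropyOfEntanglement {α β : Type*} [Fintype α] [Fintype β] [DecidableEq α] [DecidableEq β]
    (ρ : Matrix (α × β) (α × β) ℂ) : EReal :=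
  ⨅ σ ∈ separableStates α β, relEntropy ρ σ

/-- Partial transposition on the second tensor factor. -/
def partialTranspose {α β : Type*} (ρ : Matrix (α × β) (α × β) ℂ) :
    Matrix (α × β) (α × β) ℂ :=
  Matrix.of fun p q => ρ (p.1, q.2) (q.1, p.2)

/-- The trace norm `‖A‖_tr = tr √(A* A)`. -/
def traceNorm {ι : Type*} [Fintype ι] [DecidableEq ι] (A : Matrix ι ι ℂ) : ℝ :=
  (cfc Real.sqrt (A.conjTranspose * A)).trace.re

/-- The negativity `(‖ρ^Γ‖_tr - 1) / 2`. -/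
def negativity {α β : Type*} [Fintype α] [Fintype β] [DecidableEq α] [DecidableEq β]
    (ρ : Matrix (α × β) (α × β) ℂ) : ℝ :=
  (traceNorm (partialTranspose ρ) - 1) / 2

end QuantumInfo

end

/-! Write `y` in Schmidt form, with orthonormal families and squared coefficients `p i` summing to
one. For `M` the partial transpose of `|y⟩⟨y|` and `Y` the coefficient matrix, `Mᴴ * M = YYᴴ ⊗ YᴴY`,
so `2N = (∑ √(p i))² - 1 = ∑_{i ≠ j} √(p i p j)`. Deleting the coherences of `y` in its Schmidt
basis leaves a separable state, relative to which `y` has entropy exactly the Shannon entropy of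
`p`. What remains is a scalar bound (`neg_sum_mul_logb_le`): the binary case is calculus, and the
general case adds one outcome at a time. The comparison with the logarithmic bound is Bernoulli's
inequality at `x = 2N`. -/

namespace QuantumInfo

/-! ### Scalar entropy inequalities -/

open Real in
/-- The substitution `x = √(p / (1 - p))` turns the bound `2 √(p (1 - p))` on the binary entropy
into this one. -/
lemma add_inv_mul_log_sub_le {x : ℝ} (hx0 : 0 < x) (hx1 : x ≤ 1) :
    (x + x⁻¹) * log (1 + x ^ 2) - 2 * x * log x ≤ 2 * log 2 := by
  set g : ℝ → ℝ := fun x => (x + x⁻¹) * log (1 + x ^ 2) - 2 * x * log x with hg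
  have hd : ∀ x : ℝ, 0 < x → HasDerivAt g ((1 - (x ^ 2)⁻¹) * log (1 + x ^ 2) - 2 * log x) x := by
    intro x hx
    have h1 : HasDerivAt (fun x : ℝ => x + x⁻¹) (1 + -(x ^ 2)⁻¹) x :=
      (hasDerivAt_id x).add (hasDerivAt_inv hx.ne')
    have h2 : HasDerivAt (fun x : ℝ => log (1 + x ^ 2)) (2 * x / (1 + x ^ 2)) x := by
      have := ((hasDerivAt_pow 2 x).const_add 1).log (by positivity)
      simpa using this
    have h3 : HasDerivAt (fun x : ℝ => 2 * x) 2 x := by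
      simpa using (hasDerivAt_id x).const_mul 2
    refine ((h1.mul h2).sub (h3.mul (hasDerivAt_log hx.ne'))).congr_deriv ?_
    have h4 : 1 + x ^ 2 ≠ 0 := by positivity
    field_simp
    ring
  have hmono : MonotoneOn g (Set.Ioc 0 1) := by
    refine monotoneOn_of_deriv_nonneg (convex_Ioc 0 1)
      (fun x hx => (hd x hx.1).continuousAt.continuousWithinAt) ?_ ?_
    · rw [interior_Ioc]
      exact fun x hx => (hd x hx.1).differentiableAt.differentiableWithinAt
    · rw [interior_Ioc]
      intro x hx
      rw [(hd x hx.1).deriv]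
      have hx2 : 0 < x ^ 2 := pow_pos hx.1 2
      -- Since `1 - x⁻² ≤ 0`, these two bounds give derivative at least `(x² - 1) - (x² - 1) = 0`;
      -- the bound is then the value at `x = 1`.
      have h1 : log (1 + x ^ 2) ≤ x ^ 2 := by
        have := log_le_sub_one_of_pos (show 0 < 1 + x ^ 2 by positivity)
        linarith
      have h2 : 2 * log x ≤ x ^ 2 - 1 := by
        have := log_le_sub_one_of_pos hx2
        rwa [log_pow, Nat.cast_ofNat] at this
      have h3 : 0 ≤ (x ^ 2)⁻¹ - 1 := by
        have := (one_le_inv₀ hx2).2 (pow_le_one₀ hx.1.le hx.2.le)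
        linarith
      have h4 := mul_le_mul_of_nonneg_left h1 h3
      have h5 : ((x ^ 2)⁻¹ - 1) * x ^ 2 = 1 - x ^ 2 := by
        rw [sub_mul, inv_mul_cancel₀ hx2.ne', one_mul]
      linarith
  have := hmono ⟨hx0, hx1⟩ ⟨one_pos, le_rfl⟩ hx1
  simp only [hg] at this
  norm_num at this
  linarith

-- Both sides are homogeneous of degree one and symmetric, so only the ratio `a / b ≤ 1` matters.
open Real in
lemma negMulLog_add_sub_le {a b : ℝ} (ha : 0 ≤ a) (hb : 0 ≤ b) :
    negMulLog a + negMulLog b - negMulLog (a + b) ≤ 2 * log 2 * (√a * √b) := by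
  wlog hab : a ≤ b generalizing a b
  · have := this hb ha (le_of_not_ge hab)
    rw [add_comm b a, mul_comm √b] at this
    linarith
  rcases ha.eq_or_lt with rfl | ha
  · simp
  have hb : 0 < b := ha.trans_le hab
  set x := √(a / b) with hxdef
  have hx0 : 0 < x := sqrt_pos.2 (div_pos ha hb)
  have hx1 : x ≤ 1 := sqrt_le_one.2 ((div_le_one hb).2 hab)
  have hax : a = x ^ 2 * b := by
    rw [hxdef, sq_sqrt (div_pos ha hb).le]
    field_simp
  have hs : √a * √b = x * b := by
    rw [hax, sqrt_mul (by positivity), sqrt_sq hx0.le, mul_assoc, mul_self_sqrt hb.le]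
  have hmain := mul_le_mul_of_nonneg_left (add_inv_mul_log_sub_le hx0 hx1) (mul_pos hx0 hb).le
  rw [hs, hax, show x ^ 2 * b + b = (1 + x ^ 2) * b by ring]
  simp only [negMulLog]
  rw [log_mul (by positivity) hb.ne', log_mul (by positivity) hb.ne', log_pow]
  have e : x * b * ((x + x⁻¹) * log (1 + x ^ 2) - 2 * x * log x) =
      b * ((1 + x ^ 2) * log (1 + x ^ 2) - 2 * x ^ 2 * log x) := by
    field_simp
    ring
  rw [e] at hmain
  push_cast
  linarith

open Real in
lemma sqrt_sum_le_sum_sqrt {ι : Type*} (s : Finset ι) {p : ι → ℝ} (hp : ∀ i, 0 ≤ p i) :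
    √(∑ i ∈ s, p i) ≤ ∑ i ∈ s, √(p i) := by
  rw [sqrt_le_left (Finset.sum_nonneg fun i _ => sqrt_nonneg _)]
  calc ∑ i ∈ s, p i = ∑ i ∈ s, √(p i) ^ 2 :=
        Finset.sum_congr rfl fun i _ => (sq_sqrt (hp i)).symm
    _ ≤ _ := Finset.sum_sq_le_sq_sum_of_nonneg fun i _ => sqrt_nonneg _

-- By the chain rule for entropy, a new index costs one binary term, and its cross term is what the
-- square gains. Leaving the total mass free lets the induction run.
open Real in
lemma sum_negMulLog_sub_le {ι : Type*} (s : Finset ι) {p : ι → ℝ} (hp : ∀ i, 0 ≤ p i) :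
    ∑ i ∈ s, negMulLog (p i) - negMulLog (∑ i ∈ s, p i) ≤
      log 2 * ((∑ i ∈ s, √(p i)) ^ 2 - ∑ i ∈ s, p i) := by
  classical
  induction s using Finset.induction_on with
  | empty => simp
  | insert i s hi ih =>
    rw [Finset.sum_insert hi, Finset.sum_insert hi, Finset.sum_insert hi]
    have h1 := negMulLog_add_sub_le (hp i) (Finset.sum_nonneg fun j (_ : j ∈ s) => hp j)
    have h2 := mul_le_mul_of_nonneg_left
      (mul_le_mul_of_nonneg_left (sqrt_sum_le_sum_sqrt s hp) (sqrt_nonneg (p i)))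
      (show 0 ≤ 2 * log 2 by positivity)
    have h3 := sq_sqrt (hp i)
    set t := ∑ i ∈ s, √(p i)
    have h4 : log 2 * ((√(p i) + t) ^ 2 - (p i + ∑ i ∈ s, p i)) =
      log 2 * (t ^ 2 - ∑ i ∈ s, p i) + 2 * log 2 * (√(p i) * t) := by
      rw [add_sq, h3]
      ring
    rw [h4]
    linarith

/-- The Shannon entropy of a probability vector is at most `∑_{i ≠ j} √(p i p j)`. -/
lemma neg_sum_mul_logb_le {ι : Type*} [Fintype ι] {p : ι → ℝ} (hp : ∀ i, 0 ≤ p i)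
    (h1 : ∑ i, p i = 1) :
    -∑ i, p i * Real.logb 2 (p i) ≤ (∑ i, √(p i)) ^ 2 - 1 := by
  have h := sum_negMulLog_sub_le Finset.univ hp
  rw [h1, Real.negMulLog_one, sub_zero] at h
  have hl : 0 < Real.log 2 := Real.log_pos one_lt_two
  refine le_of_mul_le_mul_left (le_trans (le_of_eq ?_) h) hl
  rw [mul_neg, Finset.mul_sum, ← Finset.sum_neg_distrib]
  refine Finset.sum_congr rfl fun i _ => ?_
  rw [Real.negMulLog, Real.logb]
  field_simp

/-- On `[0, ∞)` the line `x` lies strictly below `log₂ (1 + x)` exactly between `0` and `1`. -/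
lemma lt_logb_one_add_iff {x : ℝ} (hx : 0 ≤ x) :
    x < Real.logb 2 (1 + x) ↔ 0 < x ∧ x < 1 := by
  -- Now compare `2 ^ x` with `1 + x`: Bernoulli with base `1 + 1`, whose direction flips at
  -- exponent `1`.
  rw [Real.lt_logb_iff_rpow_lt one_lt_two (by linarith)]
  constructor
  · intro h
    refine ⟨hx.lt_of_ne ?_, ?_⟩
    · rintro rfl
      simp at h
    · by_contra! h1
      have := one_add_mul_self_le_rpow_one_add (s := 1) (by norm_num) h1
      norm_num at this
      linarith
  · rintro ⟨h0, h1⟩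
    have := rpow_one_add_lt_one_add_mul_self (s := 1) (by norm_num) (by norm_num) h0 h1
    norm_num at this
    linarith

/-! ### Functional calculus and the trace norm -/

open Matrix

/-- In an eigenbasis of `M`, an entry of `X` can be nonzero only where the eigenvalue equals `d k`.
The columns of `X` need not be normalised, independent or spanning. -/
lemma cfc_mul_eq_mul_diagonal {ι κ : Type*} [Fintype ι] [DecidableEq ι] [Fintype κ]
    [DecidableEq κ] {M : Matrix ι ι ℂ} (hM : M.IsHermitian) {X : Matrix ι κ ℂ} {d : κ → ℝ}
    (h : M * X = X * diagonal fun k => (d k : ℂ)) (f : ℝ → ℝ) :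
    cfc f M * X = X * diagonal fun k => (f (d k) : ℂ) := by
  set U : Matrix ι ι ℂ := (hM.eigenvectorUnitary).1
  have hU1 : U * star U = 1 := Unitary.coe_mul_star_self _
  have hU2 : star U * U = 1 := Unitary.coe_star_mul_self _
  have hMU : M = U * diagonal (fun i => (hM.eigenvalues i : ℂ)) * star U := hM.spectral_theorem
  have hfU : cfc f M = U * diagonal (fun i => (f (hM.eigenvalues i) : ℂ)) * star U :=
    hM.cfc_eq f
  have hD : diagonal (fun i => (hM.eigenvalues i : ℂ)) * (star U * X) =
      (star U * X) * diagonal fun k => (d k : ℂ) := by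
    rw [Matrix.mul_assoc, ← h]
    nth_rw 2 [hMU]
    simp only [← Matrix.mul_assoc, hU2, Matrix.one_mul]
  have hf : diagonal (fun i => (f (hM.eigenvalues i) : ℂ)) * (star U * X) =
      (star U * X) * diagonal fun k => (f (d k) : ℂ) := by
    ext i k
    have hik := congrFun (congrFun hD i) k
    rw [diagonal_mul, mul_diagonal] at hik ⊢
    rw [mul_comm, mul_eq_mul_left_iff] at hik
    rcases hik with h | h
    · rw [Complex.ofReal_injective h, mul_comm]
    · rw [h, zero_mul, mul_zero]
  rw [hfU, Matrix.mul_assoc, Matrix.mul_assoc, hf, ← Matrix.mul_assoc, ← Matrix.mul_assoc, hU1,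
    Matrix.one_mul]

/-- The two characteristic polynomials agree up to powers of `X`, and the extra zero roots
contribute `f 0 = 0`. -/
lemma sum_apply_eigenvalues_mul_comm {α β : Type*} [Fintype α] [Fintype β] [DecidableEq α]
    [DecidableEq β] (A : Matrix α β ℂ) (B : Matrix β α ℂ) (hAB : (A * B).IsHermitian)
    (hBA : (B * A).IsHermitian) {f : ℝ → ℝ} (hf : f 0 = 0) :
    ∑ i, f (hAB.eigenvalues i) = ∑ j, f (hBA.eigenvalues j) := by
  have h := congrArg (fun q : Polynomial ℂ => (q.roots.map fun z => f z.re).sum)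
    (charpoly_mul_comm' A B)
  have hX : ∀ k : ℕ, (Polynomial.X ^ k : Polynomial ℂ) ≠ 0 := fun k =>
    (Polynomial.monic_X_pow k).ne_zero
  simpa [Polynomial.roots_mul, hX, charpoly_monic, (charpoly_monic _).ne_zero,
    hAB.roots_charpoly_eq_eigenvalues, hBA.roots_charpoly_eq_eigenvalues,
    Multiset.map_nsmul, Multiset.sum_nsmul, hf] using h

lemma traceNorm_eq_sum_mul_sum {α β : Type*} [Fintype α] [Fintype β] [DecidableEq α]
    [DecidableEq β] {M : Matrix (α × β) (α × β) ℂ} {P : Matrix α α ℂ} {Q : Matrix β β ℂ}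
    (hM : Mᴴ * M = P ⊗ₖ Q) (hP : P.PosSemidef) (hQ : Q.PosSemidef) :
    traceNorm M = (∑ i, √(hP.1.eigenvalues i)) * ∑ j, √(hQ.1.eigenvalues j) := by
  set U : Matrix α α ℂ := (hP.1.eigenvectorUnitary).1
  set V : Matrix β β ℂ := (hQ.1.eigenvectorUnitary).1
  have hU1 : U * star U = 1 := Unitary.coe_mul_star_self _
  have hU2 : star U * U = 1 := Unitary.coe_star_mul_self _
  have hV1 : V * star V = 1 := Unitary.coe_mul_star_self _
  have hV2 : star V * V = 1 := Unitary.coe_star_mul_self _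
  have hPU : P = U * diagonal (fun i => (hP.1.eigenvalues i : ℂ)) * star U :=
    hP.1.spectral_theorem
  have hQV : Q = V * diagonal (fun i => (hQ.1.eigenvalues i : ℂ)) * star V :=
    hQ.1.spectral_theorem
  have hPU' : P * U = U * diagonal (fun i => (hP.1.eigenvalues i : ℂ)) := by
    nth_rw 1 [hPU]
    rw [Matrix.mul_assoc, hU2, Matrix.mul_one]
  have hQV' : Q * V = V * diagonal (fun i => (hQ.1.eigenvalues i : ℂ)) := by
    nth_rw 1 [hQV]
    rw [Matrix.mul_assoc, hV2, Matrix.mul_one]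
  have hMX : Mᴴ * M * (U ⊗ₖ V) = (U ⊗ₖ V) *
      diagonal fun k : α × β => ((hP.1.eigenvalues k.1 * hQ.1.eigenvalues k.2 : ℝ) : ℂ) := by
    rw [hM, ← mul_kronecker_mul, hPU', hQV', mul_kronecker_mul, diagonal_kronecker_diagonal]
    push_cast
    rfl
  have h := congrArg (fun Z => (Z * (star U ⊗ₖ star V)).trace)
    (cfc_mul_eq_mul_diagonal (isHermitian_conjTranspose_mul_self M) hMX Real.sqrt)
  rw [Matrix.mul_assoc, ← mul_kronecker_mul, hU1, hV1, one_kronecker_one, Matrix.mul_one,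
    trace_mul_comm, ← Matrix.mul_assoc, ← mul_kronecker_mul, hU2, hV2, one_kronecker_one,
    Matrix.one_mul, trace_diagonal] at h
  rw [traceNorm, h, Finset.sum_mul_sum, ← Finset.sum_product', ← Complex.ofReal_sum,
    Complex.ofReal_re]
  exact Finset.sum_congr rfl fun k _ => Real.sqrt_mul (hP.eigenvalues_nonneg _) _

/-- The coefficient matrix of a bipartite vector. -/
def coeffMatrix {α β : Type*} (y : EuclideanSpace ℂ (α × β)) : Matrix α β ℂ :=
  Matrix.of fun a b => y (a, b)

/-- The transposed entry is `y (a, d) * star (y (c, b))`, so the two summation indices decouple. -/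
lemma conjTranspose_mul_self_partialTranspose_ketbra {α β : Type*} [Fintype α] [Fintype β]
    (y : EuclideanSpace ℂ (α × β)) :
    (partialTranspose (ketbra y))ᴴ * partialTranspose (ketbra y) =
      (coeffMatrix y * (coeffMatrix y)ᴴ) ⊗ₖ ((coeffMatrix y)ᴴ * coeffMatrix y) := by
  ext ⟨a, b⟩ ⟨c, d⟩
  simp only [partialTranspose, ketbra, coeffMatrix, mul_apply, conjTranspose_apply, of_apply,
    kroneckerMap_apply, Fintype.sum_prod_type, Finset.sum_mul_sum, star_mul', star_star]
  rw [Finset.sum_comm]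
  exact Finset.sum_congr rfl fun _ _ => Finset.sum_congr rfl fun _ _ => by ring

/-- The trace norm of the partial transpose of a pure state is the squared sum of its Schmidt
coefficients. -/
lemma traceNorm_partialTranspose_ketbra {α β : Type*} [Fintype α] [Fintype β] [DecidableEq α]
    [DecidableEq β] (y : EuclideanSpace ℂ (α × β)) :
    traceNorm (partialTranspose (ketbra y)) =
      (∑ i, √((isHermitian_mul_conjTranspose_self (coeffMatrix y)).eigenvalues i)) ^ 2 := by
  rw [traceNorm_eq_sum_mul_sum (conjTranspose_mul_self_partialTranspose_ketbra y)
    (posSemidef_self_mul_conjTranspose _) (posSemidef_conjTranspose_mul_self _), sq]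
  congr 1
  exact (sum_apply_eigenvalues_mul_comm _ _ _ _ Real.sqrt_zero).symm

/-! ### Relative entropy to the dephased state -/

lemma ketbra_eq_vecMulVec {ι : Type*} (y : EuclideanSpace ℂ ι) :
    ketbra y = vecMulVec y.ofLp (star y.ofLp) := rfl

lemma star_dotProduct_self_eq_norm_sq {ι : Type*} [Fintype ι] (y : EuclideanSpace ℂ ι) :
    star y.ofLp ⬝ᵥ y.ofLp = ((‖y‖ ^ 2 : ℝ) : ℂ) := by
  rw [EuclideanSpace.norm_sq_eq]
  push_cast
  exact Finset.sum_congr rfl fun i _ => by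
    simp [← Complex.conj_mul']

lemma isDensity_vecMulVec {ι : Type*} [Fintype ι] {v : ι → ℂ} (hv : star v ⬝ᵥ v = 1) :
    IsDensity (vecMulVec v (star v)) := by
  refine ⟨posSemidef_vecMulVec_self_star v, ?_⟩
  rw [trace_vecMulVec, dotProduct_comm, hv]

/-- The spectrum of a pure state is contained in `{0, 1}`, where `log₂` vanishes by convention. -/
lemma log2_ketbra {ι : Type*} [Fintype ι] [DecidableEq ι] {y : EuclideanSpace ℂ ι}
    (hy : ‖y‖ = 1) : log2 (ketbra y) = 0 := by
  have hid : IsIdempotentElem (ketbra y) := by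
    rw [ketbra_eq_vecMulVec, IsIdempotentElem, vecMulVec_mul_vecMulVec,
      star_dotProduct_self_eq_norm_sq, hy]
    simp
  have : Set.EqOn (Real.logb 2) (fun _ => 0) (spectrum ℝ (ketbra y)) := fun x hx => by
    rcases hid.spectrum_subset ℝ hx with rfl | rfl <;> simp
  rw [log2, cfc_congr this, cfc_const_zero]

/-- The relative entropy of a unit vector `∑ i, w i`, for orthogonal `w i` of squared norm `p i`,
with respect to `∑ i, |w i⟩⟨w i|`. The `w i` are the columns of `W`. -/
lemma relEntropy_ketbra_mul_conjTranspose {ι κ : Type*} [Fintype ι] [DecidableEq ι] [Fintype κ]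
    [DecidableEq κ] {y : EuclideanSpace ℂ ι} (hy : ‖y‖ = 1) {W : Matrix ι κ ℂ} {p : κ → ℝ}
    (hW : Wᴴ * W = diagonal fun k => (p k : ℂ)) (hyW : y.ofLp = W *ᵥ 1) :
    relEntropy (ketbra y) (W * Wᴴ) = ((-∑ k, p k * Real.logb 2 (p k) : ℝ) : EReal) := by
  -- The kernel of `W * Wᴴ` is that of `Wᴴ`, hence orthogonal to `y`, which lies in the range of
  -- `W`.
  have hker : ∀ v : ι → ℂ, (W * Wᴴ) *ᵥ v = 0 → ketbra y *ᵥ v = 0 := by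
    intro v hv
    rw [self_mul_conjTranspose_mulVec_eq_zero] at hv
    rw [ketbra_eq_vecMulVec, vecMulVec_mulVec, hyW, star_mulVec, ← dotProduct_mulVec, hv]
    simp
  have hL : log2 (W * Wᴴ) * W = W * diagonal fun k => (Real.logb 2 (p k) : ℂ) :=
    cfc_mul_eq_mul_diagonal (isHermitian_mul_conjTranspose_self W)
      (by rw [Matrix.mul_assoc, hW]) _
  have htr : (ketbra y * log2 (W * Wᴴ)).trace = ((∑ k, p k * Real.logb 2 (p k) : ℝ) : ℂ) := by
    rw [trace_mul_comm, ketbra_eq_vecMulVec, mul_vecMulVec, trace_vecMulVec, dotProduct_comm, hyW,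
      mulVec_mulVec, hL, star_mulVec, ← dotProduct_mulVec, mulVec_mulVec, ← Matrix.mul_assoc, hW,
      diagonal_mul_diagonal]
    simp [dotProduct, mulVec_diagonal]
  rw [relEntropy, if_pos hker, log2_ketbra hy, zero_sub, Matrix.mul_neg, trace_neg, htr,
    Complex.neg_re, Complex.ofReal_re]

/-- A mixture of product vectors `u i ⊗ g i` with orthonormal `u i` is separable. -/
lemma sum_vecMulVec_kronecker_mem_separableStates {α β κ : Type*} [Fintype α] [Fintype β]
    [Fintype κ] {u : κ → α → ℂ} {g : κ → β → ℂ} {p : κ → ℝ} (hu : ∀ k, star (u k) ⬝ᵥ u k = 1)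
    (hg : ∀ k, star (g k) ⬝ᵥ g k = p k) (hp : ∀ k, 0 ≤ p k) (hp1 : ∑ k, p k = 1) :
    ∑ k, vecMulVec (u k) (star (u k)) ⊗ₖ vecMulVec (g k) (star (g k)) ∈
      separableStates α β := by
  classical
  -- Terms of weight zero cannot be normalised to states, but they vanish and are dropped.
  have hg0 : ∀ k, p k = 0 → g k = 0 := fun k hk => by
    have := hg k
    rwa [hk, Complex.ofReal_zero, dotProduct_star_self_eq_zero] at this
  have hsum : ∑ k, vecMulVec (u k) (star (u k)) ⊗ₖ vecMulVec (g k) (star (g k)) =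
      ∑ k with p k ≠ 0, p k • (vecMulVec (u k) (star (u k)) ⊗ₖ
        ((p k)⁻¹ • vecMulVec (g k) (star (g k)))) := by
    rw [Finset.sum_filter]
    refine Finset.sum_congr rfl fun k _ => ?_
    split_ifs with hk
    · rw [kronecker_smul, smul_smul, mul_inv_cancel₀ hk, one_smul]
    · rw [hg0 k (not_not.1 hk), zero_vecMulVec, kronecker_zero]
  rw [hsum]
  refine (convex_convexHull ℝ _).sum_mem (fun k _ => hp k) ?_ fun k hk => subset_convexHull ℝ _
    ⟨_, _, isDensity_vecMulVec (hu k), ⟨?_, ?_⟩, rfl⟩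
  · rw [Finset.sum_filter_ne_zero, hp1]
  · exact (posSemidef_vecMulVec_self_star _).smul (inv_nonneg.2 (hp k))
  · rw [trace_smul, trace_vecMulVec, dotProduct_comm, hg, Complex.real_smul, ← Complex.ofReal_mul,
      inv_mul_cancel₀ (Finset.mem_filter.1 hk).2, Complex.ofReal_one]

lemma sum_eigenvalues_coeffMatrix {α β : Type*} [Fintype α] [Fintype β] [DecidableEq α]
    {y : EuclideanSpace ℂ (α × β)} (hy : ‖y‖ = 1) :
    ∑ i, (isHermitian_mul_conjTranspose_self (coeffMatrix y)).eigenvalues i = 1 := by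
  have h := (isHermitian_mul_conjTranspose_self (coeffMatrix y)).trace_eq_sum_eigenvalues
  have h2 := star_dotProduct_self_eq_norm_sq y
  have h3 : (coeffMatrix y * (coeffMatrix y)ᴴ).trace = star y.ofLp ⬝ᵥ y.ofLp := by
    simp [trace, mul_apply, coeffMatrix, dotProduct, Fintype.sum_prod_type, mul_comm]
  rw [h3, h2, hy] at h
  apply Complex.ofReal_injective
  push_cast
  simpa using h.symm

/-- The relative entropy of entanglement of a pure state is at most the Shannon entropy of its
squared Schmidt coefficients. -/
lemma relEntropyOfEntanglement_ketbra_le {α β : Type*} [Fintype α] [Fintype β] [DecidableEq α]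
    [DecidableEq β] {y : EuclideanSpace ℂ (α × β)} (hy : ‖y‖ = 1) {p : α → ℝ}
    (hp : p = (isHermitian_mul_conjTranspose_self (coeffMatrix y)).eigenvalues) :
    relEntropyOfEntanglement (ketbra y) ≤ ((-∑ i, p i * Real.logb 2 (p i) : ℝ) : EReal) := by
  set Y := coeffMatrix y with hY
  have hH := isHermitian_mul_conjTranspose_self Y
  set U : Matrix α α ℂ := hH.eigenvectorUnitary.1
  have hU1 : U * Uᴴ = 1 := Unitary.coe_mul_star_self _
  have hU2 : Uᴴ * U = 1 := Unitary.coe_star_mul_self _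
  have hYU : Y * Yᴴ = U * diagonal (fun i => (p i : ℂ)) * Uᴴ := by
    rw [hp]
    exact hH.spectral_theorem
  set G : Matrix α β ℂ := Uᴴ * Y with hG
  have hGG : G * Gᴴ = diagonal fun i => (p i : ℂ) := by
    calc G * Gᴴ = Uᴴ * (Y * Yᴴ) * U := by
          rw [hG, conjTranspose_mul, conjTranspose_conjTranspose]
          simp only [Matrix.mul_assoc]
      _ = (Uᴴ * U) * diagonal (fun i => (p i : ℂ)) * (Uᴴ * U) := by
          rw [hYU]
          simp only [Matrix.mul_assoc]
      _ = _ := by rw [hU2, Matrix.one_mul, Matrix.mul_one]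
  have hUG : U * G = Y := by rw [hG, ← Matrix.mul_assoc, hU1, Matrix.one_mul]
  -- Column `i` is the unnormalised Schmidt term `u i ⊗ g i`, with `g i` the `i`-th row of `G`, of
  -- squared norm `p i`; the columns sum to `y`.
  set W : Matrix (α × β) α ℂ := Matrix.of fun q i => U q.1 i * G i q.2 with hWdef
  have hW : Wᴴ * W = diagonal fun i => (p i : ℂ) := by
    ext i j
    have h1 : (Wᴴ * W) i j = (Uᴴ * U) i j * (G * Gᴴ) j i := by
      simp only [hWdef, mul_apply, conjTranspose_apply, of_apply, Fintype.sum_prod_type,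
        Finset.sum_mul_sum, star_mul']
      exact Finset.sum_congr rfl fun _ _ => Finset.sum_congr rfl fun _ _ => by ring
    rw [h1, hU2, hGG]
    by_cases hij : i = j
    · rw [hij, one_apply_eq, diagonal_apply_eq, one_mul]
    · simp [hij]
  have hyW : y.ofLp = W *ᵥ 1 := by
    ext ⟨a, b⟩
    have := congrFun (congrFun hUG a) b
    simpa [mul_apply, hWdef, hY, coeffMatrix, mulVec, dotProduct] using this.symm
  have hsep : W * Wᴴ ∈ separableStates α β := by
    have hsum : W * Wᴴ = ∑ k, vecMulVec (Uᵀ k) (star (Uᵀ k)) ⊗ₖ vecMulVec (G k) (star (G k)) := by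
      ext ⟨a, b⟩ ⟨c, d⟩
      rw [Matrix.sum_apply]
      simp only [hWdef, mul_apply, conjTranspose_apply, of_apply, kroneckerMap_apply,
        vecMulVec_apply, Pi.star_apply, transpose_apply, star_mul']
      exact Finset.sum_congr rfl fun _ _ => by ring
    rw [hsum]
    refine sum_vecMulVec_kronecker_mem_separableStates (p := p) (fun k => ?_) (fun k => ?_)
      (fun k => ?_) ?_
    · have := congrFun (congrFun hU2 k) k
      simpa [mul_apply, dotProduct] using this
    · have := congrFun (congrFun hGG k) k
      simpa [mul_apply, dotProduct, mul_comm] using this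
    · rw [hp]
      exact (posSemidef_self_mul_conjTranspose Y).eigenvalues_nonneg k
    · rw [hp]
      exact sum_eigenvalues_coeffMatrix hy
  rw [← relEntropy_ketbra_mul_conjTranspose hy hW hyW]
  exact iInf₂_le _ hsep

end QuantumInfo

theorem corollary3 (m n : ℕ) (y : EuclideanSpace ℂ (Fin m × Fin n)) (hy : ‖y‖ = 1) :
    QuantumInfo.relEntropyOfEntanglement (QuantumInfo.ketbra y) ≤
        ((2 * QuantumInfo.negativity (QuantumInfo.ketbra y) : ℝ) : EReal) ∧
      (2 * QuantumInfo.negativity (QuantumInfo.ketbra y) <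
          Real.logb 2 (1 + 2 * QuantumInfo.negativity (QuantumInfo.ketbra y)) ↔
        0 < QuantumInfo.negativity (QuantumInfo.ketbra y) ∧
          QuantumInfo.negativity (QuantumInfo.ketbra y) < 1 / 2) := by
  set Y := QuantumInfo.coeffMatrix y
  set p := (Matrix.isHermitian_mul_conjTranspose_self Y).eigenvalues with hp
  have hp0 : ∀ i, 0 ≤ p i := (Matrix.posSemidef_self_mul_conjTranspose Y).eigenvalues_nonneg
  have hp1 : ∑ i, p i = 1 := QuantumInfo.sum_eigenvalues_coeffMatrix hy
  have hN : 2 * QuantumInfo.negativity (QuantumInfo.ketbra y) = (∑ i, √(p i)) ^ 2 - 1 := by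
    rw [QuantumInfo.negativity, QuantumInfo.traceNorm_partialTranspose_ketbra]
    ring
  have hN0 : 0 ≤ 2 * QuantumInfo.negativity (QuantumInfo.ketbra y) := by
    have h := QuantumInfo.sqrt_sum_le_sum_sqrt Finset.univ hp0
    rw [hp1, Real.sqrt_one] at h
    rw [hN, sub_nonneg]
    exact one_le_pow₀ h
  constructor
  · rw [hN]
    exact (QuantumInfo.relEntropyOfEntanglement_ketbra_le hy hp).trans
      (EReal.coe_le_coe_iff.2 (QuantumInfo.neg_sum_mul_logb_le hp0 hp1))
  · rw [QuantumInfo.lt_logb_one_add_iff hN0]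
    constructor <;> rintro ⟨h1, h2⟩ <;> constructor <;> linarith
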